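/- Let $\mathscr T$ be a finite rooted ordered binary tree (every vertex has at most two children) with edge set $E$, let $A=(\mathbb R^d)^n$ with the Euclidean norm, and let $X=\prod_{e\in E}A$ with the Euclidean metric $d_2(x,y)=\bigl(\sum_{e\in E}\|x_e-y_e\|^2\bigr)^{1/2}$. For $x\in X$ let the collapsed tree of $x$ be the ordered rooted tree obtained from $\mathscr T$ by contracting all edges $e$ with $x_e=0$, with the attribute $x_e$ on each remaining edge $e$ and with the induced order. Write $x\sim y$ if the collapsed trees of $x$ and $y$ are isomorphic as ordered, attributed rooted trees, and let $\bar X=X/{\sim}$ be the space of ordered tree-shapes with the quotient Euclidean distance (QED) $$\bar d_2(\bar x,\bar y)=\inf\Bigl\{\sum_{i=1}^k d_2(x_i,y_i)\ :\ k\ge 1,\ x_1\in\bar x,\ y_i\sim x_{i+1}\ (1\le i<k),\ y_k\in\bar y\Bigr\},$$ which is a metric on $\bar X$. **Theorem.** There is an open dense subset $G\subseteq\bar X$ such that every $\bar x\in G$ has a radius $r>0$ for which the ball $B(\bar x,r)$, with the induced metric, is a $\mathrm{CAT}(0)$ space, and any two points of $B(\bar x,r)$ are joined by exactly one geodesic of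 $\bar X$. Here a geodesic from $a$ to $b$ in a metric space is a map $\gamma\colon[0,d(a,b)]\to Y$ with $\gamma(0)=a$, $\gamma(d(a,b))=b$ and $d(\gamma(s),\gamma(t))=|s-t|$ for all $s,t$. A metric space is $\mathrm{CAT}(0)$ if any two of its points are joined by a geodesic, and for every geodesic triangle $abc$ with planar comparison triangle $a'b'c'$ and every point $p$ of the side $bc$ with comparison point $p'\in b'c'$ one has $d(p,a)\le\|p'-a'\|$. -/

import Mathlib

noncomputable section

/-- A finite rooted ordered (planar) binary tree.  A vertex is the word of left (`false`) and
right (`true`) turns on the path leading to it from the root `[]`; every vertex has at most two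
children. -/
structure OrderedBinaryTree where
  verts : Finset (List Bool)
  root_mem : [] ∈ verts
  prefix_mem : ∀ v ∈ verts, ∀ u, u <+: v → u ∈ verts

namespace OrderedBinaryTree

/-- The edges; every edge is named by its endpoint farther from the root. -/
abbrev Edge (T : OrderedBinaryTree) : Type := ↥(T.verts.erase [])

/-- `e` lies on the path from the root to the far endpoint of `f`. -/
def Edge.IsAncestor {T : OrderedBinaryTree} (e f : T.Edge) : Prop := e.1 <+: f.1

/-- Depth-first (lexicographic) order of the edges, left before right. -/
def Edge.Precedes {T : OrderedBinaryTree} (e f : T.Edge) : Prop := e.1 < f.1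

end OrderedBinaryTree

/-- The edge attributes `(ℝ^d)^n`: `n` landmark points in `ℝ^d`, with the Euclidean norm. -/
abbrev EdgeAttribute (d n : ℕ) : Type := PiLp 2 (fun _ : Fin n => EuclideanSpace ℝ (Fin d))

/-- The tree pre-shape space `X = ∏_{e ∈ E} (ℝ^d)^n`, with the Euclidean metric
`d₂(x, y) = (∑_e ‖x_e - y_e‖²)^{1/2}`. -/
abbrev PreShape (T : OrderedBinaryTree) (d n : ℕ) : Type :=
  PiLp 2 (fun _ : T.Edge => EdgeAttribute d n)

namespace PreShape

variable {T : OrderedBinaryTree} {d n : ℕ}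

/-- The set of non-collapsed edges. -/
def edges (x : PreShape T d n) : Set T.Edge := {e | x e ≠ 0}

/-- Two pre-shapes represent the same ordered tree-shape: there is a bijection of their
non-collapsed edges which is an isomorphism of the collapsed ordered trees and preserves the
attributes.  The collapsed tree has the non-collapsed edges as its edges, with the induced
ancestor relation, and its siblings are ordered by the induced depth-first order. -/
def SameShape (x y : PreShape T d n) : Prop :=
  ∃ φ : x.edges ≃ y.edges,
    (∀ e f : x.edges, (e : T.Edge).IsAncestor f ↔ (φ e : T.Edge).IsAncestor (φ f)) ∧
    (∀ e f : x.edges, (e : T.Edge).Precedes f ↔ (φ e : T.Edge).Precedes (φ f)) ∧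
    ∀ e : x.edges, y (φ e) = x e

theorem SameShape.refl (x : PreShape T d n) : SameShape x x :=
  ⟨Equiv.refl _, fun _ _ => Iff.rfl, fun _ _ => Iff.rfl, fun _ => rfl⟩

theorem SameShape.symm {x y : PreShape T d n} (h : SameShape x y) : SameShape y x := by
  obtain ⟨φ, h1, h2, h3⟩ := h
  refine ⟨φ.symm, fun e f => ?_, fun e f => ?_, fun e => ?_⟩
  · rw [h1]; simp
  · rw [h2]; simp
  · rw [← h3]; simp

theorem SameShape.trans {x y z : PreShape T d n} (h : SameShape x y) (k : SameShape y z) :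
    SameShape x z := by
  obtain ⟨φ, h1, h2, h3⟩ := h
  obtain ⟨ψ, k1, k2, k3⟩ := k
  refine ⟨φ.trans ψ, fun e f => ?_, fun e f => ?_, fun e => ?_⟩
  · rw [h1, k1]; rfl
  · rw [h2, k2]; rfl
  · rw [← h3, ← k3]; rfl

variable (T d n) in
/-- The equivalence relation `∼` on pre-shapes. -/
def setoid : Setoid (PreShape T d n) where
  r := SameShape
  iseqv := ⟨SameShape.refl, SameShape.symm, SameShape.trans⟩

/-- Collapsing further edges is compatible with changing the representative. -/
theorem SameShape.exists_dist_eq {w w' x : PreShape T d n} (h : SameShape w w')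
    (hx : x.edges ⊆ w.edges) : ∃ x', SameShape x x' ∧ dist x' w' = dist x w := by
  classical
  obtain ⟨φ, h1, h2, h3⟩ := h
  let x' : PreShape T d n :=
    WithLp.toLp 2 (fun f => if hf : f ∈ w'.edges then x (φ.symm ⟨f, hf⟩) else 0)
  have hx'1 : ∀ e : w.edges, x' (φ e) = x e := by
    intro e
    have : (φ e : T.Edge) ∈ w'.edges := (φ e).2
    simp [x', this]
  have hx'0 : ∀ f, f ∉ w'.edges → x' f = 0 := by
    intro f hf
    simp [x', hf]
  have hx0 : ∀ e, e ∉ w.edges → x e = 0 := by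
    intro e he
    by_contra hne
    exact he (hx hne)
  have hsub : x'.edges ⊆ w'.edges := by
    intro f hf
    by_contra hne
    exact hf (hx'0 f hne)
  have hmem : ∀ e : w.edges, (e : T.Edge) ∈ x.edges ↔ (φ e : T.Edge) ∈ x'.edges := by
    intro e
    show x e ≠ 0 ↔ x' (φ e) ≠ 0
    rw [hx'1]
  let ψ : x.edges ≃ x'.edges :=
    { toFun := fun e => ⟨φ ⟨e, hx e.2⟩, (hmem ⟨e, hx e.2⟩).1 e.2⟩
      invFun := fun f => ⟨φ.symm ⟨f, hsub f.2⟩, (hmem _).2 (by simp)⟩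
      left_inv := fun e => by simp
      right_inv := fun f => by simp }
  refine ⟨x', ⟨ψ, fun e f => h1 ⟨e, hx e.2⟩ ⟨f, hx f.2⟩, fun e f => h2 ⟨e, hx e.2⟩ ⟨f, hx f.2⟩,
    fun e => hx'1 ⟨e, hx e.2⟩⟩, ?_⟩
  rw [PiLp.dist_eq_of_L2 x' w', PiLp.dist_eq_of_L2 x w]
  congr 1
  rw [Finset.sum_congr_set w'.edges (fun f => dist (x' f) (w' f) ^ 2)
      (fun f => dist (x' f) (w' f) ^ 2) (fun _ _ => rfl),
    Finset.sum_congr_set w.edges (fun f => dist (x f) (w f) ^ 2)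
      (fun f => dist (x f) (w f) ^ 2) (fun _ _ => rfl)]
  · refine (Fintype.sum_equiv φ _ _ fun e => ?_).symm
    rw [hx'1, h3]
  · intro e he
    have : w e = 0 := by by_contra hne; exact he hne
    simp [this, hx0 e he]
  · intro e he
    have : w' e = 0 := by by_contra hne; exact he hne
    simp [this, hx'0 e he]

theorem finite_sameShape (x : PreShape T d n) : {y | SameShape x y}.Finite := by
  have hfin : (insert 0 (Set.range fun e => x e)).Finite := (Set.finite_range _).insert _
  have h := Set.Finite.pi (ι := T.Edge) (fun _ => hfin)
  refine (h.image (WithLp.toLp 2)).subset ?_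
  rintro y ⟨φ, -, -, h3⟩
  refine ⟨fun e => y e, fun e _ => ?_, rfl⟩
  by_cases he : y e = 0
  · exact Or.inl he
  · refine Or.inr ⟨φ.symm ⟨e, he⟩, ?_⟩
    show x _ = _
    rw [← h3]
    simp

theorem exists_le_norm (x : PreShape T d n) :
    ∃ δ > 0, ∀ x', SameShape x x' → ∀ w : PreShape T d n, dist x' w < δ → x'.edges ⊆ w.edges := by
  classical
  obtain ⟨δ, hδ, hle⟩ : ∃ δ > 0, ∀ e, x e ≠ 0 → δ ≤ ‖x e‖ := by
    by_cases hne : (Finset.univ.filter fun e => x e ≠ 0).Nonempty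
    · obtain ⟨e, he, hmin⟩ := Finset.exists_min_image _ (fun e => ‖x e‖) hne
      exact ⟨‖x e‖, norm_pos_iff.2 (Finset.mem_filter.1 he).2, fun f hf => hmin f (by simp [hf])⟩
    · refine ⟨1, one_pos, fun e he => (hne ⟨e, by simp [he]⟩).elim⟩
  refine ⟨δ, hδ, ?_⟩
  rintro x' ⟨φ, -, -, h3⟩ w hw e he hwe
  have h1 : x' e = x (φ.symm ⟨e, he⟩) := by rw [← h3]; simp
  have h2 : δ ≤ ‖x' e‖ := by rw [h1]; exact hle _ (φ.symm ⟨e, he⟩).2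
  have h3 : ‖(x' - w) e‖ ≤ ‖x' - w‖ := PiLp.norm_apply_le _ _
  rw [PiLp.sub_apply, hwe, sub_zero, ← dist_eq_norm] at h3
  linarith

end PreShape

/-- The space `X̄ = X / ∼` of ordered tree-shapes. -/
def ShapeSpace (T : OrderedBinaryTree) (d n : ℕ) : Type := Quotient (PreShape.setoid T d n)

namespace ShapeSpace

open PreShape

variable {T : OrderedBinaryTree} {d n : ℕ}

/-- The tree-shape represented by a pre-shape. -/
def mk (x : PreShape T d n) : ShapeSpace T d n := Quotient.mk (PreShape.setoid T d n) x

theorem mk_eq_mk {x y : PreShape T d n} : mk x = mk y ↔ SameShape x y :=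
  Quotient.eq (r := PreShape.setoid T d n)

/-- The segments from `u i` to `v i`, `i = 0, …, k`, lead from `a` to `b`: the first starts in the
class `a`, each one ends at a pre-shape equivalent to the start of the next one, and the last one
ends in the class `b`. -/
def IsChain (a b : ShapeSpace T d n) (k : ℕ) (u v : ℕ → PreShape T d n) : Prop :=
  mk (u 0) = a ∧ (∀ i < k, SameShape (v i) (u (i + 1))) ∧ mk (v k) = b

/-- The total lengths of the chains of Euclidean segments from `a` to `b`. -/
def chainLengths (a b : ShapeSpace T d n) : Set ℝ :=
  {s | ∃ (k : ℕ) (u v : ℕ → PreShape T d n), IsChain a b k u v ∧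
    s = ∑ i ∈ Finset.range (k + 1), dist (u i) (v i)}

/-- The quotient Euclidean distance `d̄₂` (QED). -/
def qed (a b : ShapeSpace T d n) : ℝ := sInf (chainLengths a b)

theorem nonneg_of_mem {a b : ShapeSpace T d n} {s : ℝ} (hs : s ∈ chainLengths a b) : 0 ≤ s := by
  obtain ⟨k, u, v, -, rfl⟩ := hs
  exact Finset.sum_nonneg fun _ _ => dist_nonneg

theorem bddBelow_chainLengths (a b : ShapeSpace T d n) : BddBelow (chainLengths a b) :=
  ⟨0, fun _ hs => nonneg_of_mem hs⟩

theorem dist_mem_chainLengths (x y : PreShape T d n) :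
    dist x y ∈ chainLengths (mk x) (mk y) :=
  ⟨0, fun _ => x, fun _ => y, ⟨rfl, fun _ h => absurd h (Nat.not_lt_zero _), rfl⟩, by simp⟩

theorem chainLengths_nonempty (a b : ShapeSpace T d n) : (chainLengths a b).Nonempty := by
  induction a using Quotient.inductionOn with | _ x
  induction b using Quotient.inductionOn with | _ y
  exact ⟨_, dist_mem_chainLengths x y⟩

theorem mem_chainLengths_symm {a b : ShapeSpace T d n} {s : ℝ} (hs : s ∈ chainLengths a b) :
    s ∈ chainLengths b a := by
  obtain ⟨k, u, v, ⟨h0, h1, h2⟩, rfl⟩ := hs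
  refine ⟨k, fun i => v (k - i), fun i => u (k - i), ⟨by simpa using h2, fun i hi => ?_,
    by simpa using h0⟩, ?_⟩
  · have := (h1 (k - (i + 1)) (by omega)).symm
    rwa [show k - (i + 1) + 1 = k - i by omega] at this
  · rw [← Finset.sum_range_reflect]
    refine Finset.sum_congr rfl fun i _ => ?_
    rw [dist_comm]
    simp

theorem add_mem_chainLengths {a b c : ShapeSpace T d n} {s t : ℝ} (hs : s ∈ chainLengths a b)
    (ht : t ∈ chainLengths b c) : s + t ∈ chainLengths a c := by
  obtain ⟨k, u, v, ⟨h0, h1, h2⟩, rfl⟩ := hs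
  obtain ⟨l, u', v', ⟨h0', h1', h2'⟩, rfl⟩ := ht
  refine ⟨k + 1 + l, fun i => if i < k + 1 then u i else u' (i - (k + 1)),
    fun i => if i < k + 1 then v i else v' (i - (k + 1)), ⟨by simpa using h0, fun i hi => ?_, ?_⟩,
    ?_⟩
  · rcases lt_trichotomy i k with h | rfl | h
    · simpa [h, h.trans (Nat.lt_succ_self k)] using h1 i h
    · simpa using mk_eq_mk.1 (h2.trans h0'.symm)
    · have e1 : ¬ i < k + 1 := by omega
      have e2 : ¬ i + 1 < k + 1 := by omega
      simp only [e1, e2, if_false]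
      have := h1' (i - (k + 1)) (by omega)
      rwa [show i - (k + 1) + 1 = i + 1 - (k + 1) by omega] at this
  · have e : ¬ k + 1 + l < k + 1 := by omega
    simp only [e, if_false]
    rwa [Nat.add_sub_cancel_left]
  · rw [add_assoc (k + 1) l 1, Finset.sum_range_add _ (k + 1) (l + 1)]
    refine congrArg₂ (· + ·) ?_ ?_
    · refine Finset.sum_congr rfl fun i hi => ?_
      simp [Finset.mem_range.1 hi]
    · refine Finset.sum_congr rfl fun i _ => ?_
      have e : ¬ k + 1 + i < k + 1 := by omega
      simp only [e, if_false, Nat.add_sub_cancel_left]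

/-- A short chain starting in the class of `x` stays close to representatives of `x`. -/
theorem exists_dist_le {x : PreShape T d n} {δ : ℝ}
    (hδ : ∀ x', SameShape x x' → ∀ w : PreShape T d n, dist x' w < δ → x'.edges ⊆ w.edges)
    {k : ℕ} {u v : ℕ → PreShape T d n} (h0 : SameShape x (u 0))
    (h1 : ∀ i < k, SameShape (v i) (u (i + 1)))
    (hs : ∑ i ∈ Finset.range (k + 1), dist (u i) (v i) < δ) :
    ∃ x', SameShape x x' ∧ dist x' (v k) ≤ ∑ i ∈ Finset.range (k + 1), dist (u i) (v i) := by
  induction k with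
  | zero => exact ⟨u 0, h0, by simp⟩
  | succ k ih =>
    rw [Finset.sum_range_succ] at hs ⊢
    have hd : 0 ≤ dist (u (k + 1)) (v (k + 1)) := dist_nonneg
    obtain ⟨x', hx', hle⟩ := ih (fun i hi => h1 i (by omega)) (by linarith)
    obtain ⟨x'', hx'', heq⟩ := (h1 k (by omega)).exists_dist_eq (hδ x' hx' (v k) (by linarith))
    refine ⟨x'', hx'.trans hx'', (dist_triangle _ (u (k + 1)) _).trans ?_⟩
    linarith

theorem eq_of_qed_eq_zero {a b : ShapeSpace T d n} (h : qed a b = 0) : a = b := by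
  induction a using Quotient.inductionOn with | _ x
  induction b using Quotient.inductionOn with | _ y
  refine mk_eq_mk.2 ?_
  by_contra hne
  obtain ⟨δ, hδ, hsub⟩ := exists_le_norm x
  obtain ⟨ε, hε, hball⟩ := Metric.isOpen_iff.1 (finite_sameShape x).isClosed.isOpen_compl y hne
  obtain ⟨s, ⟨k, u, v, ⟨h0, h1, h2⟩, rfl⟩, hlt⟩ :=
    exists_lt_of_csInf_lt (chainLengths_nonempty (mk x) (mk y))
      (show sInf (chainLengths (mk x) (mk y)) < min δ ε from h.trans_lt (lt_min hδ hε))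
  obtain ⟨x', hx', hle⟩ := exists_dist_le hsub (mk_eq_mk.1 h0.symm) h1
    (hlt.trans_le (min_le_left _ _))
  have hvy : SameShape (v k) y := mk_eq_mk.1 h2
  obtain ⟨x'', hx'', heq⟩ := hvy.exists_dist_eq
    (hsub x' hx' (v k) (hle.trans_lt (hlt.trans_le (min_le_left _ _))))
  refine hball (a := x'') ?_ (hx'.trans hx'')
  rw [Metric.mem_ball, heq]
  exact hle.trans_lt (hlt.trans_le (min_le_right _ _))

/-- `X̄` with the QED metric. -/
instance : MetricSpace (ShapeSpace T d n) where
  dist := qed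
  dist_self a := by
    induction a using Quotient.inductionOn with | _ x
    refine le_antisymm (csInf_le (bddBelow_chainLengths _ _) ?_)
      (Real.sInf_nonneg fun _ hs => nonneg_of_mem hs)
    have := dist_mem_chainLengths x x
    rwa [dist_self] at this
  dist_comm a b := congrArg sInf
    (Set.ext fun _ => ⟨mem_chainLengths_symm, mem_chainLengths_symm⟩)
  dist_triangle a b c := by
    refine le_of_forall_pos_le_add fun ε hε => ?_
    obtain ⟨s, hs, hs'⟩ := exists_lt_of_csInf_lt (chainLengths_nonempty a b)
      (show sInf (chainLengths a b) < qed a b + ε / 2 by unfold qed; linarith)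
    obtain ⟨t, ht, ht'⟩ := exists_lt_of_csInf_lt (chainLengths_nonempty b c)
      (show sInf (chainLengths b c) < qed b c + ε / 2 by unfold qed; linarith)
    have := csInf_le (bddBelow_chainLengths a c) (add_mem_chainLengths hs ht)
    unfold qed at *
    linarith
  eq_of_dist_eq_zero := eq_of_qed_eq_zero

end ShapeSpace

/-- `γ`, restricted to `[0, dist a b]`, is a geodesic from `a` to `b`, parametrized by arc
length. -/
def IsGeodesic {Y : Type*} [MetricSpace Y] (a b : Y) (γ : ℝ → Y) : Prop :=
  γ 0 = a ∧ γ (dist a b) = b ∧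
    ∀ s ∈ Set.Icc 0 (dist a b), ∀ t ∈ Set.Icc 0 (dist a b), dist (γ s) (γ t) = |s - t|

/-- There is exactly one geodesic from `a` to `b`. -/
def HasUniqueGeodesic {Y : Type*} [MetricSpace Y] (a b : Y) : Prop :=
  (∃ γ, IsGeodesic a b γ) ∧
    ∀ γ γ', IsGeodesic a b γ → IsGeodesic a b γ' → Set.EqOn γ γ' (Set.Icc 0 (dist a b))

/-- `CAT(0)` spaces: any two points are joined by a geodesic, and for every geodesic triangle
`abc`, every planar comparison triangle `a'b'c'`, and every point `p` on the side `bc` with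
comparison point `p'` on `b'c'`, the distance from `p` to `a` is at most that from `p'` to `a'`. -/
def IsCAT0 (Y : Type*) [MetricSpace Y] : Prop :=
  (∀ a b : Y, ∃ γ, IsGeodesic a b γ) ∧
    ∀ (a b c : Y) (γ : ℝ → Y), IsGeodesic b c γ →
      ∀ a' b' c' : EuclideanSpace ℝ (Fin 2),
        dist a' b' = dist a b → dist b' c' = dist b c → dist a' c' = dist a c →
        ∀ t ∈ Set.Icc 0 (dist b c), ∀ p' ∈ segment ℝ b' c',
          dist b' p' = dist b (γ t) → dist p' c' = dist (γ t) c →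
          dist (γ t) a ≤ dist p' a'

/-- A property is generic if it holds on an open dense subset. -/
def IsGeneric {Y : Type*} [TopologicalSpace Y] (P : Y → Prop) : Prop :=
  ∃ G : Set Y, IsOpen G ∧ Dense G ∧ ∀ y ∈ G, P y

end

/-! The open dense set consists of the shapes represented by a pre-shape with no collapsed edge. An
equivalence out of such a pre-shape is an automorphism of the finite linear order of all edges,
hence the identity, so it has no other representative (`SameShape.eq_of_edges_eq_univ`). Pre-shapes
near it have no collapsed edge either, so a short chain starting there gains nothing from changing
representatives, and the projection maps a small Euclidean ball isometrically onto a ball of the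
quotient (`exists_isometric_ball`). In a concentric ball of a third of the radius, the CAT(0)
inequality is Stewart's equality, and geodesics of the whole quotient between its points stay in the
larger ball, where strict convexity makes them images of segments (`isCAT0_ball_of_isometric`).
Density holds because zero attributes can be perturbed, unless the attribute space is trivial and
the quotient is a point. -/

/-! ### Geodesics and comparison in balls isometric to Euclidean ones. -/

/-- Stewart's identity in an inner product space. -/
theorem dist_lineMap_sq {E : Type*} [NormedAddCommGroup E] [InnerProductSpace ℝ E]
    (a b c : E) (s : ℝ) :
    dist (AffineMap.lineMap b c s) a ^ 2 =
      (1 - s) * dist a b ^ 2 + s * dist a c ^ 2 - s * (1 - s) * dist b c ^ 2 := by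
  have h1 : AffineMap.lineMap b c s - a = (1 - s) • (b - a) + s • (c - a) := by
    rw [AffineMap.lineMap_apply_module]
    module
  have h2 : b - c = (b - a) - (c - a) := by abel
  rw [dist_comm a b, dist_comm a c, dist_eq_norm, dist_eq_norm, dist_eq_norm, dist_eq_norm, h1, h2,
    norm_add_sq_real, norm_sub_sq_real (b - a) (c - a), norm_smul, norm_smul, mul_pow, mul_pow, Real.norm_eq_abs,
    Real.norm_eq_abs, sq_abs, sq_abs, real_inner_smul_left, real_inner_smul_right]
  ring

/-- A geodesic of `Y` through points that lift isometrically to a strictly convex space is the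
image of a segment. -/
theorem IsGeodesic.eq_lineMap {E Y : Type*} [NormedAddCommGroup E] [NormedSpace ℝ E]
    [StrictConvexSpace ℝ E] [MetricSpace Y] {f : E → Y} {S : Set E}
    (hf : ∀ y ∈ S, ∀ z ∈ S, dist (f y) (f z) = dist y z) {y z : E} (hy : y ∈ S) (hz : z ∈ S)
    {γ : ℝ → Y} (hγ : IsGeodesic (f y) (f z) γ) {t : ℝ} (ht : t ∈ Set.Icc 0 (dist y z))
    (hS : γ t ∈ f '' S) : γ t = f (AffineMap.lineMap y z (t / dist y z)) := by
  obtain ⟨h0, h1, h⟩ := hγ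
  rw [hf y hy z hz] at h1 h
  obtain ⟨p, hp, hpt⟩ := hS
  have hD : 0 ≤ dist y z := dist_nonneg
  have e1 : dist y p = t := by
    rw [← hf y hy p hp, hpt, ← h0, h 0 ⟨le_rfl, hD⟩ t ht, zero_sub, abs_neg, abs_of_nonneg ht.1]
  have e2 : dist p z = dist y z - t := by
    rw [← hf p hp z hz, hpt, ← h1, h t ht _ ⟨hD, le_rfl⟩, abs_sub_comm,
      abs_of_nonneg (sub_nonneg.2 ht.2)]
  -- If `y = z`, the parameter is a division by zero, but the segment is constant.
  rcases hD.eq_or_lt with h00 | hpos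
  · have : y = p := dist_le_zero.1 (by rw [e1]; exact ht.2.trans h00.ge)
    rw [← hpt, ← dist_eq_zero.1 h00.symm, AffineMap.lineMap_same_apply, this]
  · rw [← hpt]
    -- Strict convexity: the distances to the two endpoints, adding up to `dist y z`, determine the
    -- point.
    refine congrArg f (eq_lineMap_of_dist_eq_mul_of_dist_eq_mul ?_ ?_)
    · rw [e1]; field_simp
    · rw [e2]; field_simp

/-- The affine segment from `y` to `z`, parametrized by arc length and constant outside
`[0, dist y z]`. -/
noncomputable def segmentPath {E : Type*} [NormedAddCommGroup E] [NormedSpace ℝ E] (y z : E) (t : ℝ) : E :=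
  AffineMap.lineMap y z (max 0 (min 1 (t / dist y z)))

theorem segmentPath_mem_segment {E : Type*} [NormedAddCommGroup E] [NormedSpace ℝ E] (y z : E)
    (t : ℝ) : segmentPath y z t ∈ segment ℝ y z := by
  rw [segment_eq_image_lineMap]
  exact ⟨_, ⟨le_max_left _ _, max_le zero_le_one (min_le_left _ _)⟩, rfl⟩

theorem segmentPath_eq {E : Type*} [NormedAddCommGroup E] [NormedSpace ℝ E] (y z : E) {t : ℝ}
    (ht : t ∈ Set.Icc 0 (dist y z)) :
    segmentPath y z t = AffineMap.lineMap y z (t / dist y z) := by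
  rw [segmentPath, min_eq_right (div_le_one_of_le₀ ht.2 dist_nonneg),
    max_eq_right (div_nonneg ht.1 dist_nonneg)]

theorem isGeodesic_segmentPath {E : Type*} [NormedAddCommGroup E] [NormedSpace ℝ E] (y z : E) :
    IsGeodesic y z (segmentPath y z) := by
  have hD : 0 ≤ dist y z := dist_nonneg
  refine ⟨?_, ?_, fun s hs t ht => ?_⟩
  · rw [segmentPath_eq y z ⟨le_rfl, hD⟩, zero_div, AffineMap.lineMap_apply_zero]
  · rw [segmentPath_eq y z ⟨hD, le_rfl⟩]
    rcases hD.eq_or_lt with h | h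
    · rw [dist_eq_zero.1 h.symm, AffineMap.lineMap_same_apply]
    · rw [div_self h.ne', AffineMap.lineMap_apply_one]
  · rw [segmentPath_eq y z hs, segmentPath_eq y z ht, dist_lineMap_lineMap, Real.dist_eq,
      ← sub_div, abs_div, abs_of_nonneg hD]
    rcases hD.eq_or_lt with h | h
    · have h1 : s = 0 := le_antisymm (hs.2.trans h.ge) hs.1
      have h2 : t = 0 := le_antisymm (ht.2.trans h.ge) ht.1
      simp [h1, h2]
    · field_simp

/-- A ball that is isometric, together with a concentric ball of three times the radius, to a ball
of a Euclidean space is `CAT(0)` and uniquely geodesic. -/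
theorem isCAT0_ball_of_isometric {E Y : Type*} [NormedAddCommGroup E] [InnerProductSpace ℝ E]
    [MetricSpace Y] {f : E → Y} {x : E} {r : ℝ}
    (hf : ∀ y ∈ Metric.ball x (3 * r), ∀ z ∈ Metric.ball x (3 * r), dist (f y) (f z) = dist y z)
    (hsurj : Metric.ball (f x) (3 * r) ⊆ f '' Metric.ball x (3 * r)) (hr : 0 < r) :
    IsCAT0 (Metric.ball (f x) r) ∧
      ∀ a ∈ Metric.ball (f x) r, ∀ b ∈ Metric.ball (f x) r, HasUniqueGeodesic a b := by
  have hx : x ∈ Metric.ball x (3 * r) := Metric.mem_ball_self (by linarith)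
  have hsub : Metric.ball x r ⊆ Metric.ball x (3 * r) := Metric.ball_subset_ball (by linarith)
  have hlift : ∀ a ∈ Metric.ball (f x) r, ∃ y ∈ Metric.ball x r, f y = a := by
    intro a ha
    obtain ⟨y, hy, rfl⟩ := hsurj (Metric.ball_subset_ball (by linarith) ha)
    exact ⟨y, by rwa [Metric.mem_ball, hf y hy x hx] at ha, rfl⟩
  have hmap : ∀ y ∈ Metric.ball x r, f y ∈ Metric.ball (f x) r := fun y hy => by
    rw [Metric.mem_ball, hf y (hsub hy) x hx]; exact hy
  have hpath : ∀ y ∈ Metric.ball x r, ∀ z ∈ Metric.ball x r, ∀ t,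
      segmentPath y z t ∈ Metric.ball x r := fun y hy z hz t =>
    (convex_ball x r).segment_subset hy hz (segmentPath_mem_segment y z t)
  have hgeo : ∀ y ∈ Metric.ball x r, ∀ z ∈ Metric.ball x r,
      IsGeodesic (f y) (f z) fun t => f (segmentPath y z t) := by
    intro y hy z hz
    obtain ⟨h0, h1, h⟩ := isGeodesic_segmentPath y z
    have e := hf y (hsub hy) z (hsub hz)
    refine ⟨congrArg f h0, ?_, fun s hs t ht => ?_⟩
    · rw [e]
      exact congrArg f h1
    · rw [e] at hs ht
      rw [hf _ (hsub (hpath y hy z hz s)) _ (hsub (hpath y hy z hz t)), h s hs t ht]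
  refine ⟨⟨?_, ?_⟩, ?_⟩
  · rintro ⟨a, ha⟩ ⟨b, hb⟩
    obtain ⟨y, hy, rfl⟩ := hlift a ha
    obtain ⟨z, hz, rfl⟩ := hlift b hb
    obtain ⟨h0, h1, h⟩ := hgeo y hy z hz
    exact ⟨fun t => ⟨f (segmentPath y z t), hmap _ (hpath y hy z hz t)⟩,
      Subtype.ext h0, Subtype.ext h1, h⟩
  · rintro ⟨a, ha⟩ ⟨b, hb⟩ ⟨c, hc⟩ γ ⟨h0, h1, h⟩ a' b' c' hab hbc hac t ht p' hp' hp1 -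
    obtain ⟨a, ha', rfl⟩ := hlift a ha
    obtain ⟨b, hb', rfl⟩ := hlift b hb
    obtain ⟨c, hc', rfl⟩ := hlift c hc
    have hD : dist (⟨f b, hb⟩ : Metric.ball (f x) r) ⟨f c, hc⟩ = dist b c :=
      hf b (hsub hb') c (hsub hc')
    have hgt : dist (⟨f b, hb⟩ : Metric.ball (f x) r) (γ t) = t := by
      rw [← h0, h 0 ⟨le_rfl, dist_nonneg⟩ t ht, zero_sub, abs_neg, abs_of_nonneg ht.1]
    have hab : dist a' b' = dist a b := hab.trans (hf a (hsub ha') b (hsub hb'))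
    have hbc : dist b' c' = dist b c := hbc.trans hD
    have hac : dist a' c' = dist a c := hac.trans (hf a (hsub ha') c (hsub hc'))
    -- The ball carries the induced metric, so its geodesics are geodesics of `Y`.
    have hγ : IsGeodesic (f b) (f c) fun s => (γ s : Y) :=
      ⟨congrArg Subtype.val h0, congrArg Subtype.val h1, h⟩
    rw [hgt] at hp1
    rw [hD] at ht
    have hγt := hγ.eq_lineMap hf (hsub hb') (hsub hc') ht
      (hsurj (Metric.ball_subset_ball (by linarith) (γ t).2))
    have hmem : AffineMap.lineMap b c (t / dist b c) ∈ Metric.ball x (3 * r) := by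
      rw [← segmentPath_eq b c ht]
      exact hsub (hpath b hb' c hc' t)
    have hdist : dist (γ t) ⟨f a, ha⟩ = dist (AffineMap.lineMap b c (t / dist b c)) a := by
      rw [← hf _ hmem a (hsub ha'), ← hγt]
      rfl
    -- On the segment, the distance from `b'` fixes the parameter, except when `b' = c'`, where all
    -- parameters give the same point.
    have hp'' : p' = AffineMap.lineMap b' c' (t / dist b c) := by
      rw [segment_eq_image_lineMap] at hp'
      obtain ⟨s, hs, rfl⟩ := hp'
      rw [dist_left_lineMap, Real.norm_eq_abs, abs_of_nonneg hs.1, hbc] at hp1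
      rcases (dist_nonneg : 0 ≤ dist b c).eq_or_lt with h00 | hpos
      · rw [dist_eq_zero.1 (hbc.trans h00.symm)]
        simp
      · rw [← hp1, mul_div_cancel_right₀ _ hpos.ne']
    rw [hdist, hp'']
    refine le_of_eq ((sq_eq_sq₀ dist_nonneg dist_nonneg).1 ?_)
    rw [dist_lineMap_sq, dist_lineMap_sq, hab, hbc, hac]
  · intro a ha b hb
    obtain ⟨y, hy, rfl⟩ := hlift a ha
    obtain ⟨z, hz, rfl⟩ := hlift b hb
    refine ⟨⟨_, hgeo y hy z hz⟩, ?_⟩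
    have hD := hf y (hsub hy) z (hsub hz)
    have key : ∀ γ, IsGeodesic (f y) (f z) γ → ∀ t ∈ Set.Icc 0 (dist y z),
        γ t = f (AffineMap.lineMap y z (t / dist y z)) := by
      intro γ hγ t ht
      -- Source of the factor three: the geodesic has length less than `2 * r` and starts within `r`
      -- of the center, so it cannot leave the ball of radius `3 * r`.
      refine hγ.eq_lineMap hf (hsub hy) (hsub hz) ht (hsurj ?_)
      have hd : dist (γ t) (f y) = t := by
        rw [← hγ.1, hγ.2.2 t (hD ▸ ht) 0 ⟨le_rfl, dist_nonneg⟩, sub_zero, abs_of_nonneg ht.1]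
      have h1 := dist_triangle (γ t) (f y) (f x)
      have h2 := dist_triangle_right (f y) (f z) (f x)
      rw [Metric.mem_ball] at ha hb ⊢
      have h3 := ht.2
      linarith
    intro γ γ' hγ hγ' t ht
    rw [hD] at ht
    rw [key γ hγ t ht, key γ' hγ' t ht]

theorem tendsto_add_smul_nhdsNE_zero {E : Type*} [NormedAddCommGroup E] [NormedSpace ℝ E]
    (x w : E) : Filter.Tendsto (fun c : ℝ => x + c • w) (nhdsWithin 0 {0}ᶜ) (nhds x) := by
  have h : Continuous fun c : ℝ => x + c • w := by fun_prop
  simpa using (h.tendsto 0).mono_left nhdsWithin_le_nhds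

/-! ### Pre-shapes without collapsed edges. -/

namespace PreShape

variable {T : OrderedBinaryTree} {d n : ℕ}

/-- A pre-shape without collapsed edges is the only representative of its tree-shape. -/
theorem SameShape.eq_of_edges_eq_univ {x y : PreShape T d n} (h : SameShape x y)
    (hx : x.edges = Set.univ) : y = x := by
  obtain ⟨φ, -, h2, h3⟩ := h
  let ψ : T.Edge → T.Edge := fun e => φ ⟨e, hx ▸ Set.mem_univ e⟩
  have hinj : Function.Injective ψ := fun e f hef => by
    simpa using φ.injective (Subtype.ext hef)
  let Φ : T.Edge ≃ T.Edge := Equiv.ofBijective ψ (Finite.injective_iff_bijective.1 hinj)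
  have hlt : ∀ e f : T.Edge, Φ e < Φ f ↔ e < f := fun e f =>
    (h2 ⟨e, hx ▸ Set.mem_univ e⟩ ⟨f, hx ▸ Set.mem_univ f⟩).symm
  let Ψ : T.Edge ≃o T.Edge := OrderIso.ofRelIsoLT ⟨Φ, fun {e f} => hlt e f⟩
  -- A well-founded linear order has no automorphism other than the identity.
  have hΨ : Ψ = OrderIso.refl _ := Subsingleton.elim _ _
  ext1 e
  have he : ψ e = e := congrArg (fun F : T.Edge ≃o T.Edge => F e) hΨ
  have := h3 ⟨e, hx ▸ Set.mem_univ e⟩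
  rwa [show (φ ⟨e, hx ▸ Set.mem_univ e⟩ : T.Edge) = e from he] at this

variable (T d n) in
theorem dense_edges_eq_univ [Nontrivial (EdgeAttribute d n)] :
    Dense {x : PreShape T d n | x.edges = Set.univ} := by
  classical
  obtain ⟨v, hv⟩ := exists_ne (0 : EdgeAttribute d n)
  intro x
  -- The perturbation is supported on the collapsed edges, so `x + c • w` has no zero attribute for
  -- any `c ≠ 0`, however small.
  let w : PreShape T d n := WithLp.toLp 2 fun e => if x e = 0 then v else 0
  have hlim : Filter.Tendsto (fun c : ℝ => x + c • w) (nhdsWithin 0 {0}ᶜ) (nhds x) :=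
    tendsto_add_smul_nhdsNE_zero x w
  refine mem_closure_of_tendsto hlim (eventually_mem_nhdsWithin.mono fun c hc => ?_)
  refine Set.eq_univ_of_forall fun e => ?_
  show x e + c • (if x e = 0 then v else 0) ≠ 0
  split_ifs with he
  · rw [he, zero_add]
    exact smul_ne_zero hc hv
  · rwa [smul_zero, add_zero]

end PreShape

/-! ### The projection to tree-shapes as a local isometry. -/

namespace ShapeSpace

open PreShape

variable {T : OrderedBinaryTree} {d n : ℕ}

theorem dist_mk_le (x y : PreShape T d n) : dist (mk x) (mk y) ≤ dist x y :=
  csInf_le (bddBelow_chainLengths _ _) (dist_mem_chainLengths x y)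

theorem mk_surjective : Function.Surjective (mk : PreShape T d n → ShapeSpace T d n) :=
  Quotient.mk_surjective

/-- Near a pre-shape without collapsed edges the projection to tree-shapes preserves distances. -/
theorem dist_mk_eq_of_lt {x y : PreShape T d n} {δ : ℝ} (hδ0 : 0 < δ)
    (hδ : ∀ w : PreShape T d n, dist x w < δ → w.edges = Set.univ)
    (h : dist (mk x) (mk y) < δ) : dist (mk x) (mk y) = dist x y := by
  have hx : x.edges = Set.univ := hδ x (by rwa [dist_self])
  refine le_antisymm (dist_mk_le x y) (le_of_forall_gt_imp_ge_of_dense fun ε hε => ?_)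
  obtain ⟨s, ⟨k, u, v, ⟨h0, h1, h2⟩, rfl⟩, hlt⟩ :=
    exists_lt_of_csInf_lt (chainLengths_nonempty (mk x) (mk y))
      -- The bound `δ` confines the chain to pre-shapes without collapsed edges; `ε` gives the
      -- estimate.
      (show sInf (chainLengths (mk x) (mk y)) < min δ ε from lt_min h hε)
  have hδ' : ∀ x', SameShape x x' → ∀ w : PreShape T d n, dist x' w < δ → x'.edges ⊆ w.edges := by
    intro x' hx' w hw
    rw [hx'.eq_of_edges_eq_univ hx] at hw
    rw [hδ w hw]
    exact Set.subset_univ _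
  obtain ⟨x', hx', hle⟩ := exists_dist_le hδ' (mk_eq_mk.1 h0.symm) h1
    (hlt.trans_le (min_le_left _ _))
  rw [hx'.eq_of_edges_eq_univ hx] at hle
  have hv := hδ _ (hle.trans_lt (hlt.trans_le (min_le_left _ _)))
  -- The last point of the chain has no collapsed edge, so it is `y` itself and not just equivalent
  -- to it.
  rw [(mk_eq_mk.1 h2).eq_of_edges_eq_univ hv]
  exact hle.trans (hlt.le.trans (min_le_right _ _))

/-- Around a pre-shape without collapsed edges the projection to tree-shapes is an isometry of
balls. -/
theorem exists_isometric_ball {x : PreShape T d n} (hx : x.edges = Set.univ) :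
    ∃ r > 0, (∀ y ∈ Metric.ball x r, y.edges = Set.univ) ∧
      (∀ y ∈ Metric.ball x r, ∀ z ∈ Metric.ball x r, dist (mk y) (mk z) = dist y z) ∧
      Metric.ball (mk x) r ⊆ mk '' Metric.ball x r := by
  obtain ⟨δ, hδ, hsub⟩ := exists_le_norm x
  have hfull : ∀ w, dist x w < δ → w.edges = Set.univ := fun w hw =>
    Set.univ_subset_iff.1 (hx ▸ hsub x (SameShape.refl x) w hw)
  -- With radius `δ / 4`, two points of the ball are less than `δ / 2` apart, and the `δ / 2`-ball
  -- around either stays within `δ` of `x`.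
  refine ⟨δ / 4, by linarith, fun y hy => hfull y ?_, fun y hy z hz => ?_, fun a ha => ?_⟩
  · rw [Metric.mem_ball'] at hy
    linarith
  · rw [Metric.mem_ball'] at hy
    rw [Metric.mem_ball] at hz
    refine dist_mk_eq_of_lt (half_pos hδ) (fun w hw => hfull w ?_) ?_
    · linarith [dist_triangle x y w]
    · linarith [dist_mk_le y z, dist_triangle y x z, dist_comm x y, dist_comm x z]
  · obtain ⟨y, rfl⟩ := mk_surjective a
    rw [Metric.mem_ball'] at ha
    refine ⟨y, ?_, rfl⟩
    rwa [Metric.mem_ball', ← dist_mk_eq_of_lt hδ hfull (by linarith)]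

variable (T d n) in
theorem isOpen_mk_edges_eq_univ :
    IsOpen (mk '' {x : PreShape T d n | x.edges = Set.univ}) := by
  refine Metric.isOpen_iff.2 ?_
  rintro _ ⟨x, hx, rfl⟩
  obtain ⟨r, hr, hfull, -, hsurj⟩ := exists_isometric_ball hx
  exact ⟨r, hr, hsurj.trans (Set.image_mono hfull)⟩

-- The projection is 1-Lipschitz and surjective, so it carries dense sets to dense sets.
variable (T d n) in
theorem dense_mk_edges_eq_univ [Nontrivial (EdgeAttribute d n)] :
    Dense (mk '' {x : PreShape T d n | x.edges = Set.univ}) :=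
  mk_surjective.denseRange.dense_image
    (LipschitzWith.of_dist_le_mul (K := 1) fun x y => by simpa using dist_mk_le x y).continuous
    (dense_edges_eq_univ T d n)

end ShapeSpace

/-! ### The generic statement. -/

theorem mainTheorem6 (T : OrderedBinaryTree) (d n : ℕ) :
    IsGeneric fun x : ShapeSpace T d n =>
      ∃ r > 0, IsCAT0 (Metric.ball x r) ∧
        ∀ a ∈ Metric.ball x r, ∀ b ∈ Metric.ball x r, HasUniqueGeodesic a b := by
  -- When the only attribute is zero, every edge is collapsed and the set used below may be empty;
  -- the quotient is then a single point.
  rcases subsingleton_or_nontrivial (EdgeAttribute d n) with hA | hA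
  · have hX : Subsingleton (PreShape T d n) := ⟨fun x y => by ext1 e; exact Subsingleton.elim _ _⟩
    have hS : Subsingleton (ShapeSpace T d n) := ShapeSpace.mk_surjective.subsingleton
    refine ⟨Set.univ, isOpen_univ, dense_univ, fun a _ => ?_⟩
    obtain ⟨x, rfl⟩ := ShapeSpace.mk_surjective a
    refine ⟨1, one_pos, isCAT0_ball_of_isometric (fun y _ z _ => ?_) (fun b _ => ?_) one_pos⟩
    · rw [Subsingleton.elim y z, dist_self, dist_self]
    · exact ⟨x, Metric.mem_ball_self (by norm_num), Subsingleton.elim _ _⟩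
  · refine ⟨_, ShapeSpace.isOpen_mk_edges_eq_univ T d n, ShapeSpace.dense_mk_edges_eq_univ T d n, ?_⟩
    rintro _ ⟨x, hx, rfl⟩
    obtain ⟨r, hr, -, hiso, hsurj⟩ := ShapeSpace.exists_isometric_ball hx
    have e : 3 * (r / 3) = r := by ring
    exact ⟨r / 3, by positivity, isCAT0_ball_of_isometric (by rwa [e]) (by rwa [e]) (by positivity)⟩
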